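/- Throughout, rings are associative with $1$, and "hereditary" and "noetherian" are two-sided: every left ideal and every right ideal of a hereditary ring is projective, and a noetherian ring is both left and right noetherian. Let $R$ be a hereditary noetherian semiprime ring (semiprime: $aRa=0$ implies $a=0$) which is a right order in a semisimple ring $A$; that is, $R$ is a subring of $A$ (via an injective ring homomorphism $R\to A$), every regular element (two-sided non-zero-divisor) of $R$ is invertible in $A$, and every element of $A$ has the form $rs^{-1}$ with $r,s\in R$ and $s$ regular. Suppose that there is no primitive central idempotent $e$ of $A$ such that the ring $eRe=\{ere : r\in R\}$ (with identity $e$) is simple artinian. Let $J\subseteq I$ be right ideals of $R$. Then $I/J$ is an artinian right $R$-module if and only if $J$ is an essential submodule of $I$, i.e. $J\cap K\neq 0$ for every nonzero right ideal $K\subseteq I$. -/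

import Mathlib

/-- A ring is (left and right) hereditary if all its left ideals and all its right ideals are
projective modules. Right modules over `R` are modules over `Rᵐᵒᵖ`; in particular right ideals
of `R` are the `Rᵐᵒᵖ`-submodules of `R`. -/
structure IsHereditaryRing (R : Type*) [Ring R] : Prop where
  left : ∀ I : Submodule R R, Module.Projective R I
  right : ∀ I : Submodule Rᵐᵒᵖ R, Module.Projective Rᵐᵒᵖ I

/-- A (not necessarily commutative) ring is semiprime if `a R a = 0` implies `a = 0`. -/
def IsSemiprimeRing (R : Type*) [Ring R] : Prop :=
  ∀ a : R, (∀ r : R, a * r * a = 0) → a = 0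

/-- The injective ring homomorphism `f : R → A` exhibits `R` as a right order in `A`: `A` is the
right Ore localization of `R` at the set of its regular elements (two-sided non-zero-divisors),
i.e. the regular elements become units in `A` and each element of `A` has the
form `f r * (f s)⁻¹` with `s` regular. -/
structure IsRightOrder {R A : Type*} [Ring R] [Ring A] (f : R →+* A) : Prop where
  injective : Function.Injective f
  isUnit_of_regular : ∀ s ∈ nonZeroDivisors R, IsUnit (f s)
  exists_fraction : ∀ a : A, ∃ r : R, ∃ s ∈ nonZeroDivisors R, a * f s = f r

/-- `e` is a primitive central idempotent of `A`: a nonzero central idempotent which is not the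
sum of two nonzero orthogonal central idempotents. -/
structure IsPrimitiveCentralIdempotent {A : Type*} [Ring A] (e : A) : Prop where
  idem : IsIdempotentElem e
  central : IsMulCentral e
  ne_zero : e ≠ 0
  primitive : ∀ e₁ e₂ : A, IsIdempotentElem e₁ → IsMulCentral e₁ →
    IsIdempotentElem e₂ → IsMulCentral e₂ → e₁ * e₂ = 0 → e₁ + e₂ = e → e₁ = 0 ∨ e₂ = 0

/-- For a central idempotent `e` of `A`, the ring homomorphism `R → eAe`, `r ↦ e r e`. -/
def cornerHom {R A : Type*} [Ring R] [Ring A] (f : R →+* A) {e : A}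
    (he : IsIdempotentElem e) (hc : IsMulCentral e) : R →+* he.Corner where
  toFun r := ⟨e * f r * e, f r, rfl⟩
  map_zero' := Subtype.ext (by simp; rfl)
  map_one' := Subtype.ext (by simp [he.eq]; rfl)
  map_add' x y := Subtype.ext (by
    change e * f (x + y) * e = e * f x * e + e * f y * e
    rw [map_add, mul_add, add_mul])
  map_mul' x y := Subtype.ext (by
    change e * f (x * y) * e = (e * f x * e) * (e * f y * e)
    have h : f x * e = e * f x := (hc.comm (f x)).eq.symm
    simp only [map_mul, mul_assoc]
    rw [← mul_assoc e e, he.eq, ← mul_assoc (f x) e, h, mul_assoc, ← mul_assoc e e, he.eq])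

/-- The ring `eRe = {e r e | r ∈ R}` with identity `e`, a subring of the corner ring `eAe`, for a
central idempotent `e` of `A` (`e` need not lie in `R`). -/
def cornerSubring {R A : Type*} [Ring R] [Ring A] (f : R →+* A) {e : A}
    (he : IsIdempotentElem e) (hc : IsMulCentral e) : Subring he.Corner :=
  (cornerHom f he hc).range

/-- A submodule is essential if it meets every nonzero submodule nontrivially. -/
def IsEssentialSubmodule {S M : Type*} [Ring S] [AddCommGroup M] [Module S M]
    (N : Submodule S M) : Prop :=
  ∀ K : Submodule S M, K ≠ ⊥ → N ⊓ K ≠ ⊥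

/-! If `J` is essential in `I`, adding a right ideal `K` maximal with `K ⊓ I = ⊥` makes it essential
in `R`, so `J ⊔ K` contains a regular `s` because `A` is semisimple. On right ideals `N` containing
`s`, the map to left ideals `N ↦ {r | r s⁻¹ N ⊆ R}` reverses inclusions, strictly since `N` is
projective (`mem_of_forall_dualIdeal`). Left noetherianity thus gives the descending chain condition
above `s`.

Conversely, a nonzero `K ≤ I` missing `J` embeds in `I/J`, so it is artinian. Then `R` has a minimal
two-sided ideal `T` that is right artinian. Semiprimeness gives `T = eR` with `e` a central
idempotent, primitive in `A`, and `eRe ≅ T` is simple artinian, which is excluded. -/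

open MulOpposite in
theorem Submodule.mul_mem_of_mulOpposite {R : Type*} [Ring R] (N : Submodule Rᵐᵒᵖ R) {x : R}
    (hx : x ∈ N) (r : R) : x * r ∈ N :=
  N.smul_mem (op r) hx

theorem isSemisimpleModule_mulOpposite_self (A : Type*) [Ring A] [IsSemisimpleRing A] :
    IsSemisimpleModule Aᵐᵒᵖ A :=
  let e : A ≃ₗ[Aᵐᵒᵖ] Aᵐᵒᵖ :=
    { MulOpposite.opAddEquiv with map_smul' := fun _ _ => rfl }
  IsSemisimpleModule.congr e

theorem IsMulCentral.mul_comm' {A : Type*} [Ring A] {e : A} (he : IsMulCentral e) (a : A) :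
    e * a = a * e :=
  (he.comm a).eq

/-! ### Essential right ideals and regular elements -/

namespace IsRightOrder

variable {R A : Type*} [Ring R] [Ring A] {f : R →+* A}

theorem exists_common_multiple (order : IsRightOrder f) (r : R) {s : R}
    (hs : s ∈ nonZeroDivisors R) : ∃ r', ∃ s' ∈ nonZeroDivisors R, s * r' = r * s' := by
  obtain ⟨u, hu⟩ := order.isUnit_of_regular s hs
  obtain ⟨r', s', hs', h⟩ := order.exists_fraction (↑u⁻¹ * f r)
  refine ⟨r', s', hs', order.injective ?_⟩
  rw [map_mul, map_mul, ← h, ← hu, mul_assoc, Units.mul_inv_cancel_left]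

/-- The right ideal of `A` generated by a right ideal `J` of a right order `R` in `A`. -/
def extend (order : IsRightOrder f) (J : Submodule Rᵐᵒᵖ R) : Submodule Aᵐᵒᵖ A where
  carrier := {a | ∃ j ∈ J, ∃ s ∈ nonZeroDivisors R, a * f s = f j}
  zero_mem' := ⟨0, J.zero_mem, 1, one_mem _, by simp⟩
  add_mem' := by
    rintro a b ⟨j, hj, s, hs, ha⟩ ⟨k, hk, t, ht, hb⟩
    obtain ⟨r, u, hu, h⟩ := order.exists_common_multiple t hs
    refine ⟨j * r + k * u, J.add_mem (J.mul_mem_of_mulOpposite hj r)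
      (J.mul_mem_of_mulOpposite hk u), t * u, mul_mem ht hu, ?_⟩
    rw [add_mul, map_add, map_mul f k, map_mul f j, ← ha, ← hb, mul_assoc, mul_assoc,
      ← map_mul, ← map_mul, h]
  smul_mem' := by
    rintro c a ⟨j, hj, s, hs, ha⟩
    obtain ⟨u, hu⟩ := order.isUnit_of_regular s hs
    obtain ⟨r, t, ht, h⟩ := order.exists_fraction (↑u⁻¹ * c.unop)
    refine ⟨j * r, J.mul_mem_of_mulOpposite hj r, t, ht, ?_⟩
    change a * c.unop * f t = _
    rw [map_mul, ← ha, ← h, ← hu]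
    simp [mul_assoc]

/-- A nonzero complement of `JA` in `A` would contain some `f r ≠ 0`, and `rR` would miss `J`. Hence
`1 ∈ JA`, and clearing the denominator puts a regular element in `J`. -/
theorem exists_regular_mem [IsSemisimpleRing A] (order : IsRightOrder f)
    {J : Submodule Rᵐᵒᵖ R} (hJ : IsEssentialSubmodule J) : ∃ s ∈ nonZeroDivisors R, s ∈ J := by
  have := isSemisimpleModule_mulOpposite_self A
  obtain ⟨B, hB⟩ := exists_isCompl (order.extend J)
  have hbot : B = ⊥ := by
    rw [Submodule.eq_bot_iff]
    intro b hb
    by_contra hb0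
    obtain ⟨r, s, hs, h⟩ := order.exists_fraction b
    have hr : f r ∈ B := h ▸ B.mul_mem_of_mulOpposite hb (f s)
    have hr0 : r ≠ 0 := by
      rintro rfl
      rw [map_zero, (order.isUnit_of_regular s hs).mul_left_eq_zero] at h
      exact hb0 h
    refine hJ (Submodule.span Rᵐᵒᵖ {r}) (by simpa using hr0) ?_
    rw [Submodule.eq_bot_iff]
    rintro x ⟨hxJ, hx⟩
    obtain ⟨c, rfl⟩ := Submodule.mem_span_singleton.1 hx
    apply order.injective
    rw [map_zero]
    refine Submodule.disjoint_def.1 hB.disjoint _ ⟨_, hxJ, 1, one_mem _, by simp⟩ ?_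
    change f (r * c.unop) ∈ B
    rw [map_mul]
    exact B.mul_mem_of_mulOpposite hr _
  have h1 : (1 : A) ∈ order.extend J := by
    rw [show order.extend J = ⊤ by simpa [hbot] using hB.sup_eq_top]
    trivial
  obtain ⟨j, hj, s, hs, h⟩ := h1
  rw [one_mul] at h
  exact ⟨s, hs, order.injective h ▸ hj⟩

end IsRightOrder

/-! ### Duality between right and left ideals -/

/-- For `u ∈ A` and a right ideal `N` of `R`, the left ideal of all `r ∈ R` with `r u N ⊆ R`. -/
def dualIdeal {R A : Type*} [Ring R] [Ring A] (f : R →+* A) (u : A) (N : Submodule Rᵐᵒᵖ R) :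
    Submodule R R where
  carrier := {r | ∀ n ∈ N, f r * u * f n ∈ f.range}
  zero_mem' := fun n _ => by simp
  add_mem' := fun {a b} ha hb n hn => by
    rw [map_add, add_mul, add_mul]
    exact add_mem (ha n hn) (hb n hn)
  smul_mem' := fun c a ha n hn => by
    rw [smul_eq_mul, map_mul, mul_assoc, mul_assoc, ← mul_assoc (f a)]
    exact mul_mem ⟨c, rfl⟩ (ha n hn)

namespace IsRightOrder

variable {R A : Type*} [Ring R] [Ring A] {f : R →+* A}

/-- Dual basis argument: write `s = ∑ n σₙ(s)`. Each `σₙ(s)` lies in the dual ideal, so `x = s u x =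
∑ n (σₙ(s) u x)` has its coefficients in `R`. -/
theorem mem_of_forall_dualIdeal (order : IsRightOrder f) {s : R} (hs : s ∈ nonZeroDivisors R)
    {u : A} (hu : f s * u = 1) (hu' : u * f s = 1) {N : Submodule Rᵐᵒᵖ R}
    [Module.Projective Rᵐᵒᵖ N] (hsN : s ∈ N) {x : R}
    (hx : ∀ r ∈ dualIdeal f u N, f r * u * f x ∈ f.range) : x ∈ N := by
  obtain ⟨σ, hσ⟩ := Module.projective_def.1 ‹Module.Projective Rᵐᵒᵖ N›
  have hmem : ∀ n : N, (σ ⟨s, hsN⟩ n).unop ∈ dualIdeal f u N := by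
    intro n x hxN
    -- From `s y = x t` follows `σₙ(s) y = σₙ(x) t`, that is, `σₙ(x) = σₙ(s) s⁻¹ x`.
    obtain ⟨y, t, ht, h⟩ := order.exists_common_multiple x hs
    have h1 : MulOpposite.op y • (⟨s, hsN⟩ : N) = MulOpposite.op t • ⟨x, hxN⟩ := Subtype.ext h
    have h2 := congrArg (fun g => (g n).unop) (congrArg σ h1)
    simp only [map_smul, Finsupp.smul_apply, smul_eq_mul, MulOpposite.unop_mul,
      MulOpposite.unop_op] at h2
    refine ⟨(σ ⟨x, hxN⟩ n).unop, ?_⟩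
    rw [← (order.isUnit_of_regular t ht).mul_left_inj, ← map_mul, ← h2, mul_assoc, ← map_mul f x,
      ← h, map_mul, map_mul, mul_assoc, ← mul_assoc u, hu', one_mul]
  choose y hy using fun n : N => hx _ (hmem n)
  have hs_sum := congrArg (Submodule.subtype N) (hσ ⟨s, hsN⟩)
  rw [Finsupp.linearCombination_apply, Finsupp.sum, map_sum] at hs_sum
  have hx_sum : x = ∑ n ∈ (σ ⟨s, hsN⟩).support, (n : R) * y n := by
    apply order.injective
    calc f x = f s * u * f x := by rw [hu, one_mul]
      _ = f (∑ n ∈ (σ ⟨s, hsN⟩).support, (n : R) * (σ ⟨s, hsN⟩ n).unop) * u * f x :=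
        congrArg (fun z => f z * u * f x) hs_sum.symm
      _ = _ := by
        simp only [map_sum, map_mul, hy, Finset.sum_mul, mul_assoc]
  rw [hx_sum]
  exact N.sum_mem fun n _ => N.mul_mem_of_mulOpposite n.2 _

theorem isArtinian_quotient_of_regular_mem (order : IsRightOrder f)
    (hered : ∀ I : Submodule Rᵐᵒᵖ R, Module.Projective Rᵐᵒᵖ I) [IsNoetherian R R]
    {J : Submodule Rᵐᵒᵖ R} {s : R} (hs : s ∈ nonZeroDivisors R) (hsJ : s ∈ J) :
    IsArtinian Rᵐᵒᵖ (R ⧸ J) := by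
  obtain ⟨v, hv⟩ := order.isUnit_of_regular s hs
  have hu : f s * (↑v⁻¹ : A) = 1 := by rw [← hv, Units.mul_inv]
  have hu' : (↑v⁻¹ : A) * f s = 1 := by rw [← hv, Units.inv_mul]
  have hanti : StrictAnti fun N : Submodule Rᵐᵒᵖ (R ⧸ J) =>
      dualIdeal f (↑v⁻¹ : A) (N.comap J.mkQ) := by
    intro N N' hlt
    refine lt_of_le_of_ne (fun r hr n hn => hr n (hlt.le hn)) fun heq => hlt.not_ge ?_
    have hsN : s ∈ N.comap J.mkQ := by simp [(Submodule.Quotient.mk_eq_zero J).2 hsJ]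
    have := hered (N.comap J.mkQ)
    rw [← Submodule.comap_le_comap_iff_of_surjective J.mkQ_surjective]
    intro x hx
    refine order.mem_of_forall_dualIdeal hs hu hu' hsN fun r hr => ?_
    exact heq.ge hr x hx
  exact hanti.wellFoundedLT

end IsRightOrder

theorem Submodule.exists_disjoint_isEssentialSubmodule_sup {S M : Type*} [Ring S] [AddCommGroup M]
    [Module S M] [IsNoetherian S M] {I J : Submodule S M}
    (hess : IsEssentialSubmodule (J.submoduleOf I)) :
    ∃ K : Submodule S M, K ⊓ I = ⊥ ∧ IsEssentialSubmodule (J ⊔ K) := by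
  have hess' : ∀ L ≤ I, L ≠ ⊥ → J ⊓ L ≠ ⊥ := by
    intro L hL hL0 h
    refine hess (L.submoduleOf I) ?_ ?_
    · intro h'
      refine hL0 ((Submodule.eq_bot_iff _).2 fun x hx => ?_)
      exact congrArg Subtype.val ((Submodule.eq_bot_iff _).1 h' ⟨x, hL hx⟩ hx)
    · rw [Submodule.eq_bot_iff]
      rintro x ⟨h1, h2⟩
      exact Subtype.ext ((Submodule.eq_bot_iff _).1 h _ ⟨h1, h2⟩)
  obtain ⟨K, hK, hmax⟩ := set_has_maximal_iff_noetherian.2 ‹IsNoetherian S M›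
    {K : Submodule S M | K ⊓ I = ⊥} ⟨⊥, bot_inf_eq _⟩
  -- If `L` misses `J ⊔ K` but `L ≰ K`, then `J` meets `(K ⊔ L) ⊓ I` in some `k + l ≠ 0`. Here `l ∈
  -- J ⊔ K` forces `l = 0`, and then `k ∈ K ⊓ I = ⊥`.
  refine ⟨K, hK, fun L hL h => hL ?_⟩
  by_cases hLK : K ⊔ L = K
  · rw [← h, right_eq_inf]
    exact (sup_eq_left.1 hLK).trans le_sup_right
  have h1 : (K ⊔ L) ⊓ I ≠ ⊥ := fun h' => hmax _ h' (lt_of_le_of_ne le_sup_left (Ne.symm hLK))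
  obtain ⟨x, ⟨hxJ, hx, hxI⟩, hx0⟩ := Submodule.exists_mem_ne_zero_of_ne_bot
    (hess' _ inf_le_right h1)
  obtain ⟨k, hk, l, hl, rfl⟩ := Submodule.mem_sup.1 hx
  have hl' : l ∈ J ⊔ K := by
    rw [← add_sub_cancel_left k l]
    exact sub_mem (Submodule.mem_sup_left hxJ) (Submodule.mem_sup_right hk)
  obtain rfl : l = 0 := (Submodule.eq_bot_iff _).1 h l ⟨hl', hl⟩
  rw [add_zero] at hxI hx0
  exact (hx0 ((Submodule.eq_bot_iff _).1 hK k ⟨hk, hxI⟩)).elim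

theorem IsRightOrder.isArtinian_quotient_of_isEssentialSubmodule {R A : Type*} [Ring R] [Ring A]
    {f : R →+* A} [IsSemisimpleRing A] (order : IsRightOrder f)
    (hered : ∀ I : Submodule Rᵐᵒᵖ R, Module.Projective Rᵐᵒᵖ I) [IsNoetherian R R]
    [IsNoetherian Rᵐᵒᵖ R] {I J : Submodule Rᵐᵒᵖ R} (hJI : J ≤ I)
    (hess : IsEssentialSubmodule (J.submoduleOf I)) :
    IsArtinian Rᵐᵒᵖ (I ⧸ J.submoduleOf I) := by
  obtain ⟨K, hKI, hK⟩ := Submodule.exists_disjoint_isEssentialSubmodule_sup hess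
  obtain ⟨s, hs, hsJ⟩ := order.exists_regular_mem hK
  have := order.isArtinian_quotient_of_regular_mem hered hs hsJ
  -- Modular law: `(J ⊔ K) ⊓ I = J`, so `I/J` embeds in `R/(J ⊔ K)`.
  have hcomap : J.submoduleOf I = (J ⊔ K).comap I.subtype := by
    ext x
    refine ⟨fun hx => Submodule.mem_sup_left (S := J) hx, fun hx => ?_⟩
    have : (x : R) ∈ (J ⊔ K) ⊓ I := ⟨hx, x.2⟩
    rwa [sup_inf_assoc_of_le K hJI, hKI, sup_bot_eq] at this
  refine isArtinian_of_injective (Submodule.mapQ _ (J ⊔ K) I.subtype hcomap.le) ?_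
  rw [← LinearMap.ker_eq_bot, Submodule.ker_mapQ, ← hcomap, Submodule.mkQ_map_self]

/-! ### Artinian two-sided ideals and central idempotents -/

/-- Left multiplication by an element as an endomorphism of the right module `R`. -/
def mulLeftRight {R : Type*} [Ring R] (r : R) : R →ₗ[Rᵐᵒᵖ] R where
  toFun x := r * x
  map_add' := mul_add r
  map_smul' c x := (mul_assoc r x c.unop).symm

/-- A right artinian nonzero right ideal yields an artinian minimal two-sided ideal. -/
theorem exists_minimal_twoSided_of_isArtinian {R : Type*} [Ring R] [IsNoetherian Rᵐᵒᵖ R]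
    (K : Submodule Rᵐᵒᵖ R) (hK : K ≠ ⊥) [IsArtinian Rᵐᵒᵖ K] :
    ∃ T : Submodule Rᵐᵒᵖ R, T ≠ ⊥ ∧ IsArtinian Rᵐᵒᵖ T ∧ (∀ r, ∀ x ∈ T, r * x ∈ T) ∧
      ∀ N : Submodule Rᵐᵒᵖ R, N ≤ T → N ≠ ⊥ → (∀ r, ∀ x ∈ N, r * x ∈ N) → N = T := by
  -- `L` is the largest artinian right ideal; it is two-sided because each `rL` is a quotient of
  -- `L`.
  obtain ⟨L, hL, hmax⟩ := set_has_maximal_iff_noetherian.2 ‹IsNoetherian Rᵐᵒᵖ R›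
    {L : Submodule Rᵐᵒᵖ R | IsArtinian Rᵐᵒᵖ L} ⟨K, ‹_›⟩
  have hL : IsArtinian Rᵐᵒᵖ L := hL
  have hle : ∀ N : Submodule Rᵐᵒᵖ R, IsArtinian Rᵐᵒᵖ N → N ≤ L := by
    intro N hN
    by_contra h
    exact hmax (L ⊔ N) (isArtinian_sup L N) (left_lt_sup.2 h)
  have hLtwo : ∀ r, ∀ x ∈ L, r * x ∈ L := by
    intro r x hx
    have : IsArtinian Rᵐᵒᵖ (L.map (mulLeftRight r)) := by
      rw [← Submodule.range_subtype L, ← LinearMap.range_comp]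
      infer_instance
    exact hle _ this ⟨x, hx, rfl⟩
  obtain ⟨T, ⟨hT0, hT⟩, hmin⟩ := IsArtinian.set_has_minimal
    {T : Submodule Rᵐᵒᵖ L | T ≠ ⊥ ∧ ∀ r, ∀ x ∈ T.map L.subtype, r * x ∈ T.map L.subtype}
    ⟨⊤, fun h => hK (eq_bot_iff.2 ((hle K ‹_›).trans (by
      rw [← Submodule.map_subtype_top L, h, Submodule.map_bot]))), by simpa using hLtwo⟩
  have hTL : T.map L.subtype ≤ L := Submodule.map_subtype_le L T
  refine ⟨T.map L.subtype, ?_, isArtinian_of_le hTL, hT, fun N hNT hN0 hN => ?_⟩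
  · rwa [Ne, ← Submodule.map_bot L.subtype,
      (Submodule.map_injective_of_injective L.injective_subtype).eq_iff]
  · have hmap : (N.submoduleOf L).map L.subtype = N := by
      rw [Submodule.submoduleOf, Submodule.map_comap_subtype, inf_eq_right.2 (hNT.trans hTL)]
    have hNT' : N.submoduleOf L ≤ T := by
      rwa [← Submodule.map_le_map_iff_of_injective L.injective_subtype, hmap]
    rw [← hmap]
    congr 1
    by_contra hne
    refine hmin (N.submoduleOf L) ⟨fun h => hN0 ?_, by rwa [hmap]⟩ (lt_of_le_of_ne hNT' hne)
    rw [← hmap, h, Submodule.map_bot]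

/-- The sum of a two-sided ideal and its left annihilator in a semiprime ring is essential. -/
theorem IsSemiprimeRing.exists_isEssentialSubmodule {R : Type*} [Ring R] (T : Submodule Rᵐᵒᵖ R)
    (hT : ∀ r, ∀ x ∈ T, r * x ∈ T) :
    ∃ U : Submodule Rᵐᵒᵖ R, (∀ u ∈ U, ∀ x ∈ T, u * x = 0) ∧ IsEssentialSubmodule (T ⊔ U) := by
  let U : Submodule Rᵐᵒᵖ R :=
    { carrier := {u | ∀ x ∈ T, u * x = 0}
      zero_mem' := fun x _ => zero_mul x
      add_mem' := fun {a b} ha hb x hx => by rw [add_mul, ha x hx, hb x hx, add_zero]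
      smul_mem' := fun c u hu x hx => by
        change u * c.unop * x = 0
        rw [mul_assoc]
        exact hu _ (hT _ x hx) }
  refine ⟨U, fun u hu => hu, fun K hK h => hK ?_⟩
  rw [← h, right_eq_inf]
  intro k hk
  refine Submodule.mem_sup_right fun x hx => ?_
  exact (Submodule.eq_bot_iff _).1 h _
    ⟨Submodule.mem_sup_left (hT k x hx), K.mul_mem_of_mulOpposite hk x⟩

/-- An artinian two-sided ideal of a semiprime right order in a semisimple ring is generated by a
central idempotent. -/
theorem IsRightOrder.exists_central_idempotent {R A : Type*} [Ring R] [Ring A]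
    {f : R →+* A} [IsSemisimpleRing A] (order : IsRightOrder f) (semiprime : IsSemiprimeRing R)
    (T : Submodule Rᵐᵒᵖ R) [IsArtinian Rᵐᵒᵖ T] (hT : ∀ r, ∀ x ∈ T, r * x ∈ T) :
    ∃ e ∈ T, (∀ x ∈ T, e * x = x) ∧ ∀ r, e * r = r * e := by
  obtain ⟨U, hU, hess⟩ := IsSemiprimeRing.exists_isEssentialSubmodule T hT
  obtain ⟨s, hs, hsTU⟩ := order.exists_regular_mem hess
  obtain ⟨t, ht, u, hu, rfl⟩ := Submodule.mem_sup.1 hsTU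
  have hmul : ∀ x ∈ T, (t + u) * x = t * x := fun x hx => by rw [add_mul, hU u hu x hx, add_zero]
  have hcancel : ∀ x y, (t + u) * x = (t + u) * y → x = y := fun x y hxy => by
    rw [← sub_eq_zero]
    refine hs.1 _ ?_
    rw [mul_sub, hxy, sub_self]
  -- An injective endomorphism of an artinian module is onto. Since `t + u` acts on `T` as `t`, a
  -- preimage `e` of `t` is a left identity of `T`.
  let φ : T →ₗ[Rᵐᵒᵖ] T := (mulLeftRight (t + u)).restrict (fun x hx => hT _ x hx)
  have hφ : Function.Injective φ := fun x y hxy =>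
    Subtype.ext (hcancel _ _ (congrArg Subtype.val hxy))
  obtain ⟨⟨e, he⟩, hte⟩ := IsArtinian.surjective_of_injective_endomorphism φ hφ ⟨t, ht⟩
  have hte : (t + u) * e = t := congrArg Subtype.val hte
  have hid : ∀ x ∈ T, e * x = x := fun x hx =>
    hcancel _ _ (by rw [← mul_assoc, hte, hmul x hx])
  refine ⟨e, he, hid, fun r => ?_⟩
  have h1 : ∀ r, e * (r * e) = r * e := fun r => hid _ (hT r e he)
  -- `(1 - e)Re = 0` makes `eR(1 - e)` square to zero, even with `R` inserted in between.
  have h2 : e * r - e * r * e = 0 := by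
    refine semiprime _ fun c => ?_
    have h3 : (e * r - e * r * e) * (c * e) = 0 := by
      rw [sub_mul, sub_eq_zero, mul_assoc (e * r), h1]
    have h4 : e * r - e * r * e = e * (r - r * e) := by rw [mul_sub, mul_assoc]
    calc _ = (e * r - e * r * e) * (c * e) * (r - r * e) := by
          conv_lhs => rw [h4]
          rw [h4]
          simp only [mul_assoc]
      _ = 0 := by rw [h3, zero_mul]
  rw [sub_eq_zero.1 h2, mul_assoc, h1]

theorem IsRightOrder.isMulCentral_map {R A : Type*} [Ring R] [Ring A]
    {f : R →+* A} (order : IsRightOrder f) {e : R} (he : ∀ r, e * r = r * e) :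
    IsMulCentral (f e) := by
  rw [isMulCentral_iff]
  refine ⟨fun a => ?_, fun a b => (mul_assoc _ _ _).symm, fun a b => mul_assoc _ _ _⟩
  obtain ⟨r, s, hs, h⟩ := order.exists_fraction a
  rw [Commute, SemiconjBy, ← (order.isUnit_of_regular s hs).mul_left_inj, mul_assoc, h, mul_assoc,
    ← map_mul, ← map_mul, he s, map_mul f s, ← mul_assoc, h, ← map_mul, he]

theorem IsRightOrder.isPrimitiveCentralIdempotent_map {R A : Type*} [Ring R] [Ring A]
    {f : R →+* A} (order : IsRightOrder f) {T : Submodule Rᵐᵒᵖ R} (hT0 : T ≠ ⊥)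
    (hmin : ∀ N : Submodule Rᵐᵒᵖ R, N ≤ T → N ≠ ⊥ → (∀ r, ∀ x ∈ N, r * x ∈ N) → N = T)
    {e : R} (heT : e ∈ T) (hid : ∀ x ∈ T, e * x = x) (hc : ∀ r, e * r = r * e) :
    IsPrimitiveCentralIdempotent (f e) where
  idem := by rw [IsIdempotentElem, ← map_mul, hid e heT]
  central := order.isMulCentral_map hc
  ne_zero h := hT0 <| (Submodule.eq_bot_iff _).2 fun x hx => by
    rw [← hid x hx, (map_eq_zero_iff f order.injective).1 h, zero_mul]
  primitive e₁ e₂ h₁ hc₁ h₂ hc₂ h12 hsum := by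
    by_contra! hne
    have he₁ : f e * e₁ = e₁ := by
      rw [← hsum, add_mul, h₁.eq, ← hc₁.mul_comm', h12, add_zero]
    -- `N = R ∩ e₁A` is a nonzero two-sided ideal inside `T`, so it contains `e`; this forces `e₂ =
    -- 0`.
    let N : Submodule Rᵐᵒᵖ R :=
      { carrier := {x | e₁ * f x = f x}
        zero_mem' := by simp
        add_mem' := fun {a b} ha hb => by
          change e₁ * f (a + b) = f (a + b)
          rw [map_add, mul_add, ha, hb]
        smul_mem' := fun c x (hx : e₁ * f x = f x) => by
          change e₁ * f (x * c.unop) = f (x * c.unop)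
          rw [map_mul, ← mul_assoc, hx] }
    have hNT : N ≤ T := by
      intro x (hx : e₁ * f x = f x)
      have : e * x = x := order.injective <| by
        rw [map_mul, ← hx, ← mul_assoc, he₁]
      exact this ▸ T.mul_mem_of_mulOpposite heT x
    have hN : ∀ r, ∀ x ∈ N, r * x ∈ N := by
      intro r x (hx : e₁ * f x = f x)
      change e₁ * f (r * x) = f (r * x)
      rw [map_mul, ← mul_assoc, hc₁.mul_comm', mul_assoc, hx]
    have hN0 : N ≠ ⊥ := by
      intro h
      obtain ⟨r, s, hs, hrs⟩ := order.exists_fraction e₁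
      have hr : r ∈ N := by
        change e₁ * f r = f r
        rw [← hrs, ← mul_assoc, h₁.eq]
      rw [(Submodule.eq_bot_iff _).1 h r hr, map_zero,
        (order.isUnit_of_regular s hs).mul_left_eq_zero] at hrs
      exact hne.1 hrs
    have heN : e₁ * f e = f e := by
      have : e ∈ N := hmin N hNT hN0 hN ▸ heT
      exact this
    apply hne.2
    have : e₁ + e₂ = e₁ := by
      rw [hsum, ← heN, ← hsum, mul_add, h₁.eq, h12, add_zero]
    simpa using this

/-! ### The corner ring `eRe` -/

section Corner

variable {R A : Type*} [Ring R] [Ring A] {f : R →+* A} {T : Submodule Rᵐᵒᵖ R} {e : R}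

theorem cornerHom_rangeRestrict_eq_iff (hf : Function.Injective f)
    (hi : IsIdempotentElem (f e)) (hcf : IsMulCentral (f e)) (x y : R) :
    (cornerHom f hi hcf).rangeRestrict x = (cornerHom f hi hcf).rangeRestrict y ↔
      e * x = e * y := by
  have key : ∀ x, f e * f x * f e = f (e * x) := fun x => by
    rw [mul_assoc, ← hcf.mul_comm', ← mul_assoc, hi.eq, map_mul]
  refine Subtype.ext_iff.trans (Subtype.ext_iff.trans ?_)
  change f e * f x * f e = f e * f y * f e ↔ _
  rw [key, key, hf.eq_iff]

/-- A nonzero ideal of `eRe` pulls back to a nonzero two-sided ideal inside `T`, hence to `T`, which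
contains `e`; and `e` maps to `1`. -/
theorem isSimpleRing_cornerSubring (hf : Function.Injective f) (hT0 : T ≠ ⊥)
    (hmin : ∀ N : Submodule Rᵐᵒᵖ R, N ≤ T → N ≠ ⊥ → (∀ r, ∀ x ∈ N, r * x ∈ N) → N = T)
    (hT : ∀ r, ∀ x ∈ T, r * x ∈ T)
    (heT : e ∈ T) (hid : ∀ x ∈ T, e * x = x)
    (hi : IsIdempotentElem (f e)) (hcf : IsMulCentral (f e)) :
    IsSimpleRing (cornerSubring f hi hcf) := by
  have hg := cornerHom_rangeRestrict_eq_iff hf hi hcf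
  let g : R →+* cornerSubring f hi hcf := (cornerHom f hi hcf).rangeRestrict
  have hgs : Function.Surjective g := (cornerHom f hi hcf).rangeRestrict_surjective
  have hg0 : ∀ x, g x = 0 ↔ e * x = 0 := fun x => by
    rw [← map_zero g]
    exact (hg x 0).trans (by rw [mul_zero])
  have : Nontrivial (cornerSubring f hi hcf) := by
    refine ⟨1, 0, fun h => hT0 ?_⟩
    rw [← map_one g, hg0, mul_one] at h
    exact (Submodule.eq_bot_iff _).2 fun x hx => by rw [← hid x hx, h, zero_mul]
  refine IsSimpleRing.of_eq_bot_or_eq_top fun I => or_iff_not_imp_left.2 fun hI => ?_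
  let N : Submodule Rᵐᵒᵖ R :=
    { carrier := {x | x ∈ T ∧ g x ∈ I}
      zero_mem' := ⟨T.zero_mem, by rw [map_zero]; exact I.zero_mem⟩
      add_mem' := fun {a b} ha hb =>
        ⟨T.add_mem ha.1 hb.1, by rw [map_add]; exact I.add_mem ha.2 hb.2⟩
      smul_mem' := fun c x hx => ⟨T.smul_mem c hx.1, by
        change g (x * c.unop) ∈ I
        rw [map_mul]
        exact I.mul_mem_right _ _ hx.2⟩ }
  have hN0 : N ≠ ⊥ := by
    intro hN
    apply hI
    rw [eq_bot_iff]
    intro y hy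
    obtain ⟨x, rfl⟩ := hgs y
    have hx : e * x ∈ N :=
      ⟨T.mul_mem_of_mulOpposite heT x, by rw [map_mul]; exact I.mul_mem_left _ _ hy⟩
    exact (TwoSidedIdeal.mem_bot _).2 ((hg0 x).2 ((Submodule.eq_bot_iff _).1 hN _ hx))
  have heN : e ∈ N := by
    rw [hmin N (fun x hx => hx.1) hN0 fun r x hx =>
      ⟨hT r x hx.1, by rw [map_mul]; exact I.mul_mem_left _ _ hx.2⟩]
    exact heT
  have hge : g e = 1 := by
    rw [← map_one g]
    exact (hg e 1).2 (by rw [hid e heT, mul_one])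
  exact I.one_mem_iff.1 (hge ▸ heN.2)

/-- `T` gives the right artinian condition, while `IsArtinianRing` is the left one. For simple rings
each amounts to semisimplicity, which is left-right symmetric. -/
theorem isArtinianRing_cornerSubring (hf : Function.Injective f) [IsArtinian Rᵐᵒᵖ T]
    (heT : e ∈ T) (hid : ∀ x ∈ T, e * x = x)
    (hi : IsIdempotentElem (f e)) (hcf : IsMulCentral (f e))
    [IsSimpleRing (cornerSubring f hi hcf)] :
    IsArtinianRing (cornerSubring f hi hcf) := by
  have hg := cornerHom_rangeRestrict_eq_iff hf hi hcf
  let g : R →+* cornerSubring f hi hcf := (cornerHom f hi hcf).rangeRestrict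
  let φ : T →ₛₗ[g.op] (cornerSubring f hi hcf)ᵐᵒᵖ :=
    { toFun := fun x => MulOpposite.op (g x)
      map_add' := fun x y => by rw [Submodule.coe_add, map_add, MulOpposite.op_add]
      map_smul' := fun c x => by
        change MulOpposite.op (g (x * c.unop)) = _
        rw [map_mul]
        rfl }
  have hφ : Function.Surjective φ := by
    intro y
    obtain ⟨x, hx⟩ := (cornerHom f hi hcf).rangeRestrict_surjective y.unop
    refine ⟨⟨e * x, T.mul_mem_of_mulOpposite heT x⟩, MulOpposite.unop_injective ?_⟩
    exact ((hg _ _).2 (by rw [← mul_assoc, hid e heT])).trans hx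
  have : RingHomSurjective g.op := ⟨fun y => by
    obtain ⟨x, hx⟩ := (cornerHom f hi hcf).rangeRestrict_surjective y.unop
    exact ⟨MulOpposite.op x, MulOpposite.unop_injective hx⟩⟩
  have hart : IsArtinianRing (cornerSubring f hi hcf)ᵐᵒᵖ :=
    (Submodule.comap_strictMono_of_surjective hφ).wellFoundedLT
  have := IsSimpleRing.isSemisimpleRing_iff_isArtinianRing.2 hart
  exact IsSimpleRing.isSemisimpleRing_iff_isArtinianRing.1 (isSemisimpleRing_mulOpposite_iff.1 this)

end Corner

theorem mainTheorem10 {R : Type*} {A : Type*} [Ring R] [Ring A]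
    (hered : IsHereditaryRing R)
    (noethLeft : IsNoetherian R R) (noethRight : IsNoetherian Rᵐᵒᵖ R)
    (semiprime : IsSemiprimeRing R)
    (semisimple : IsSemisimpleRing A)
    (f : R →+* A) (order : IsRightOrder f)
    (no_simple_artinian : ∀ (e : A) (he : IsPrimitiveCentralIdempotent e),
      ¬ (IsSimpleRing (cornerSubring f he.idem he.central) ∧
          IsArtinianRing (cornerSubring f he.idem he.central)))
    (I J : Submodule Rᵐᵒᵖ R) (hJI : J ≤ I) :
    IsArtinian Rᵐᵒᵖ (↥I ⧸ J.submoduleOf I) ↔ IsEssentialSubmodule (J.submoduleOf I) := by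
  refine ⟨fun hart K hK hJK => ?_,
    order.isArtinian_quotient_of_isEssentialSubmodule hered.right hJI⟩
  have hinj : Function.Injective ((J.submoduleOf I).mkQ ∘ₗ K.subtype) := by
    refine (injective_iff_map_eq_zero _).2 fun x hx => Subtype.ext ?_
    exact (Submodule.eq_bot_iff _).1 hJK x ⟨(Submodule.Quotient.mk_eq_zero _).1 hx, x.2⟩
  have hKart : IsArtinian Rᵐᵒᵖ K := isArtinian_of_injective _ hinj
  have : IsArtinian Rᵐᵒᵖ (K.map I.subtype) := by
    rw [← Submodule.range_subtype K, ← LinearMap.range_comp]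
    infer_instance
  obtain ⟨T, hT0, hTart, hT, hmin⟩ := exists_minimal_twoSided_of_isArtinian (K.map I.subtype)
    (by rwa [Ne, ← Submodule.map_bot I.subtype,
      (Submodule.map_injective_of_injective I.injective_subtype).eq_iff])
  obtain ⟨e, heT, hid, hc⟩ := order.exists_central_idempotent semiprime T hT
  have he := order.isPrimitiveCentralIdempotent_map hT0 hmin heT hid hc
  have hsimple := isSimpleRing_cornerSubring order.injective hT0 hmin hT heT hid
    he.idem he.central
  exact no_simple_artinian (f e) he
    ⟨hsimple, isArtinianRing_cornerSubring order.injective heT hid he.idem he.central⟩
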